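/- Let $G$ be a finite simple graph on $n$ vertices, with $\{0,1\}$ adjacency matrix $A$, diagonal degree matrix $D$ and average degree $d=\frac1n\sum_v \deg(v)$. (1) (Moore bound for irregular graphs) If $d>2$, then $G$ has a cycle of length at most $2\left(\lfloor \log_{d-1} n\rfloor+1\right)$. (2) For every even integer $\ell\ge 2$, if $G$ has no cycle of length at most $\ell$, then $$A \preceq n^{2/\ell}\, I + n^{-2/\ell}\,(D-I),$$ where $X\preceq Y$ means that $Y-X$ is positive semidefinite. (Here $d>2$ is not assumed.) -/

import Mathlib

/-- The average degree `(∑ v, deg v) / n` of a finite simple graph on `n` vertices. -/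
noncomputable def SimpleGraph.averageDegree {V : Type*} [Fintype V] (G : SimpleGraph V)
    [DecidableRel G.Adj] : ℝ :=
  (∑ v : V, (G.degree v : ℝ)) / (Fintype.card V : ℝ)

/-- `G` contains a cycle with at most `m` edges. -/
def SimpleGraph.HasCycleOfLengthLE {V : Type*} (G : SimpleGraph V) (m : ℕ) : Prop :=
  ∃ (v : V) (p : G.Walk v v), p.IsCycle ∧ p.length ≤ m

/-! Let `M t = 1 - tA + t²(D - 1)` and `ℓ = 2k`. As in the Ihara–Bass formula, a kernel vector `x`
of `M t` lifts to `g u v = x v - t * x u`, an eigenfunction of the non-backtracking operator with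
eigenvalue `1/t`. Without cycles of length at most `2k`, the non-backtracking continuations of an
edge by `k` steps have distinct ends, so `t⁻ᵏ ≤ n`. Thus `M t` is nonsingular for `0 < t <
n^(-1/k)`; since `M 0 = 1`, it stays positive semidefinite up to `t = n^(-1/k)`, and scaling gives
(2). Testing (2) on the all-ones vector gives (1). -/

namespace SimpleGraph

/-! ### Paths in graphs without short cycles -/

variable {V : Type*} {G : SimpleGraph V}

/-- Without cycles of length at most `m`, a path is determined by its ends among the paths whose
lengths add up to at most `m`. -/
theorem Walk.IsPath.eq_of_not_hasCycleOfLengthLE {m : ℕ} (hG : ¬ G.HasCycleOfLengthLE m) {u v : V}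
    {p q : G.Walk u v} (hp : p.IsPath) (hq : q.IsPath) (hm : p.length + q.length ≤ m) :
    p = q := by
  classical
  -- A cycle in the union `H` of the two paths repeats no edge, so its length is at most `m`. Hence
  -- `H` is a forest, where paths are unique.
  let H : SimpleGraph V := fromEdgeSet {e | e ∈ p.edges ++ q.edges}
  have hHG : ∀ e ∈ H.edgeSet, e ∈ G.edgeSet := by
    intro e he
    have he' : e ∈ p.edges ++ q.edges := by
      rw [edgeSet_fromEdgeSet] at he
      exact he.1
    rcases List.mem_append.1 he' with h | h
    · exact p.edges_subset_edgeSet h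
    · exact q.edges_subset_edgeSet h
  have hH : ∀ e ∈ p.edges ++ q.edges, e ∈ H.edgeSet := by
    intro e he
    rw [edgeSet_fromEdgeSet]
    refine ⟨he, fun hd => ?_⟩
    rcases List.mem_append.1 he with h | h
    · exact G.not_isDiag_of_mem_edgeSet (p.edges_subset_edgeSet h) hd
    · exact G.not_isDiag_of_mem_edgeSet (q.edges_subset_edgeSet h) hd
  have hpH : ∀ e ∈ p.edges, e ∈ H.edgeSet := fun e he => hH e (List.mem_append_left _ he)
  have hqH : ∀ e ∈ q.edges, e ∈ H.edgeSet := fun e he => hH e (List.mem_append_right _ he)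
  have hacyc : H.IsAcyclic := by
    intro w c hc
    have hcG : ∀ e ∈ c.edges, e ∈ G.edgeSet := fun e he => hHG e (c.edges_subset_edgeSet he)
    refine hG ⟨w, c.transfer G hcG, hc.transfer hcG, ?_⟩
    have hsub : c.edges ⊆ p.edges ++ q.edges := by
      intro e he
      have := c.edges_subset_edgeSet he
      rw [edgeSet_fromEdgeSet] at this
      exact this.1
    have hlen := (List.subperm_of_subset hc.edges_nodup hsub).length_le
    simp only [List.length_append, Walk.length_edges] at hlen
    rw [Walk.length_transfer]
    lia
  have huniq := congrArg Subtype.val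
    ((hacyc.subsingleton_path u v).elim ⟨p.transfer H hpH, hp.transfer hpH⟩
      ⟨q.transfer H hqH, hq.transfer hqH⟩)
  refine Walk.ext_support ?_
  simpa using congrArg Walk.support huniq

/-- The ends of the paths of length `j` from `v` that avoid `u`. -/
def avoidingSphere (G : SimpleGraph V) (j : ℕ) (u v : V) : Set V :=
  {z | ∃ p : G.Walk v z, p.IsPath ∧ p.length = j ∧ u ∉ p.support}

/-- If the path from `w` met `u`, then prepending `v` would give a second path from `v` to `u`
besides the edge. -/
theorem avoidingSphere_subset_succ {m j : ℕ} (hG : ¬ G.HasCycleOfLengthLE m) (hj : j + 2 ≤ m)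
    {u v w : V} (huv : G.Adj u v) (hvw : G.Adj v w) (hwu : w ≠ u) :
    G.avoidingSphere j v w ⊆ G.avoidingSphere (j + 1) u v := by
  classical
  rintro z ⟨p, hp, hpj, hv⟩
  refine ⟨.cons hvw p, hp.cons hv, by simp [hpj], ?_⟩
  rw [Walk.support_cons, List.mem_cons, not_or]
  refine ⟨huv.ne, fun hu => ?_⟩
  have hp' : (p.takeUntil u hu).IsPath := hp.takeUntil hu
  have hv' : v ∉ (p.takeUntil u hu).support :=
    fun h => hv (p.support_takeUntil_subset_support hu h)
  have hlen := p.length_takeUntil_le_length hu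
  have heq := Walk.IsPath.eq_of_not_hasCycleOfLengthLE hG (hp'.cons (h := hvw) hv')
    (q := .cons huv.symm .nil) (by simp [huv.ne']) (by simp; lia)
  have h := congrArg Walk.snd heq
  simp only [Walk.snd_cons] at h
  exact hwu h

theorem disjoint_avoidingSphere {m j : ℕ} (hG : ¬ G.HasCycleOfLengthLE m) (hj : 2 * (j + 1) ≤ m)
    {v w w' : V} (hvw : G.Adj v w) (hvw' : G.Adj v w') (hne : w ≠ w') :
    Disjoint (G.avoidingSphere j v w) (G.avoidingSphere j v w') := by
  rw [Set.disjoint_left]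
  rintro z ⟨p, hp, hpj, hv⟩ ⟨q, hq, hqj, hv'⟩
  have heq := Walk.IsPath.eq_of_not_hasCycleOfLengthLE hG (hp.cons (h := hvw) hv)
    (hq.cons (h := hvw') hv') (by simp; lia)
  have h := congrArg Walk.snd heq
  simp only [Walk.snd_cons] at h
  exact hne h

/-! ### Growth of non-backtracking eigenfunctions -/

variable [Fintype V]

/-- An eigenfunction of the non-backtracking operator grows at most like the sizes of the
spheres. -/
theorem abs_mul_pow_le_ncard_avoidingSphere [DecidableEq V] [DecidableRel G.Adj] {k : ℕ}
    (hG : ¬ G.HasCycleOfLengthLE (2 * k)) {g : V → V → ℝ} {r C : ℝ} (hr : 0 ≤ r)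
    (hg : ∀ u v, G.Adj u v → ∑ w ∈ (G.neighborFinset v).erase u, g v w = r * g u v)
    (hC : ∀ u v, G.Adj u v → |g u v| ≤ C) {j : ℕ} (hj : j ≤ k) {u v : V} (huv : G.Adj u v) :
    r ^ j * |g u v| ≤ C * (G.avoidingSphere j u v).ncard := by
  induction j generalizing u v with
  | zero =>
    have hC0 : 0 ≤ C := (abs_nonneg _).trans (hC u v huv)
    have h1 : 1 ≤ (G.avoidingSphere 0 u v).ncard :=
      (Set.ncard_pos (Set.toFinite _)).2 ⟨v, .nil, by simp, by simp, by simp [huv.ne]⟩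
    have h1' : (1 : ℝ) ≤ (G.avoidingSphere 0 u v).ncard := by exact_mod_cast h1
    rw [pow_zero, one_mul]
    exact (hC u v huv).trans (le_mul_of_one_le_right hC0 h1')
  | succ j ih =>
    have hC0 : 0 ≤ C := (abs_nonneg _).trans (hC u v huv)
    set N := (G.neighborFinset v).erase u with hN
    have hNmem : ∀ w ∈ N, w ≠ u ∧ G.Adj v w := by
      intro w hw
      simpa [hN] using hw
    -- The spheres beyond the different `w` are disjoint subsets of the next sphere.
    have hcard : ∑ w ∈ N, (G.avoidingSphere j v w).ncard ≤ (G.avoidingSphere (j + 1) u v).ncard := by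
      classical
      simp_rw [Set.ncard_eq_toFinset_card']
      rw [← Finset.card_biUnion]
      · refine Finset.card_le_card (Finset.biUnion_subset.2 fun w hw => ?_)
        rw [Set.toFinset_subset_toFinset]
        exact avoidingSphere_subset_succ hG (by lia) huv (hNmem w hw).2 (hNmem w hw).1
      · intro w hw w' hw' hne
        exact Set.disjoint_toFinset.2 <| disjoint_avoidingSphere hG (by lia) (hNmem w hw).2 (hNmem w' hw').2 hne
    calc r ^ (j + 1) * |g u v| = r ^ j * |∑ w ∈ N, g v w| := by
          rw [hg u v huv, abs_mul, abs_of_nonneg hr, pow_succ, mul_assoc]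
      _ ≤ r ^ j * ∑ w ∈ N, |g v w| := by
          gcongr
          exact Finset.abs_sum_le_sum_abs _ _
      _ = ∑ w ∈ N, r ^ j * |g v w| := Finset.mul_sum _ _ _
      _ ≤ ∑ w ∈ N, C * (G.avoidingSphere j v w).ncard :=
          Finset.sum_le_sum fun w hw => ih (by lia) (hNmem w hw).2
      _ = C * ((∑ w ∈ N, (G.avoidingSphere j v w).ncard : ℕ) : ℝ) := by
          rw [Nat.cast_sum, Finset.mul_sum]
      _ ≤ C * (G.avoidingSphere (j + 1) u v).ncard := by gcongr

/-- Without cycles of length at most `2 * k`, the `k`-th power of an eigenvalue of the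
non-backtracking operator is at most the number of vertices. -/
theorem pow_le_card_of_nonbacktracking_eigenfunction [DecidableEq V] [DecidableRel G.Adj] {k : ℕ}
    (hG : ¬ G.HasCycleOfLengthLE (2 * k)) {g : V → V → ℝ} {r : ℝ} (hr : 0 ≤ r)
    (hg : ∀ u v, G.Adj u v → ∑ w ∈ (G.neighborFinset v).erase u, g v w = r * g u v)
    (hne : ∃ u v, G.Adj u v ∧ g u v ≠ 0) : r ^ k ≤ Fintype.card V := by
  obtain ⟨a, b, hab, hgab⟩ := hne
  -- At an edge maximizing `|g|`, the bound `C` equals `|g u v|` and cancels.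
  obtain ⟨⟨u, v⟩, huv, hmax⟩ := Finset.exists_max_image
    (Finset.univ.filter fun e : V × V => G.Adj e.1 e.2) (fun e => |g e.1 e.2|)
    ⟨(a, b), by simpa using hab⟩
  simp only [Finset.mem_filter, Finset.mem_univ, true_and, Prod.forall] at huv hmax
  have hpos : 0 < |g u v| := (abs_pos.2 hgab).trans_le (hmax a b hab)
  have h := abs_mul_pow_le_ncard_avoidingSphere hG hr hg hmax le_rfl huv
  rw [mul_comm] at h
  refine (le_of_mul_le_mul_left h hpos).trans ?_
  rw [← Nat.card_eq_fintype_card]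
  exact_mod_cast Set.ncard_le_card _

/-! ### The Ihara matrix and its kernel -/

variable [DecidableEq V] [DecidableRel G.Adj]

variable (G) in
/-- The matrix `1 - tA + t²(D - 1)` of the Ihara–Bass formula. -/
noncomputable def iharaMatrix (t : ℝ) : Matrix V V ℝ :=
  1 - t • G.adjMatrix ℝ + t ^ 2 • (G.degMatrix ℝ - 1)

open Matrix

theorem iharaMatrix_mulVec_apply (t : ℝ) (x : V → ℝ) (v : V) :
    (G.iharaMatrix t *ᵥ x) v =
      x v - t * ∑ w ∈ G.neighborFinset v, x w + t ^ 2 * (G.degree v * x v - x v) := by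
  simp [iharaMatrix, add_mulVec, sub_mulVec, smul_mulVec, degMatrix_mulVec_apply,
    adjMatrix_mulVec_apply]

theorem isHermitian_iharaMatrix (t : ℝ) : (G.iharaMatrix t).IsHermitian := by
  have h1 : (t • G.adjMatrix ℝ).IsHermitian := by
    simp [IsHermitian]
  have h2 : (t ^ 2 • (G.degMatrix ℝ - 1)).IsHermitian := by
    rw [IsHermitian, conjTranspose_smul, conjTranspose_sub, (G.isHermitian_degMatrix ℝ).eq,
      conjTranspose_one, star_trivial]
  exact (isHermitian_one.sub h1).add h2

theorem eq_zero_of_iharaMatrix_mulVec_eq_zero {k : ℕ} (hG : ¬ G.HasCycleOfLengthLE (2 * k))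
    {t : ℝ} (ht0 : 0 < t) (ht1 : t < 1) (htk : t ^ k * Fintype.card V < 1) {x : V → ℝ}
    (hx : G.iharaMatrix t *ᵥ x = 0) : x = 0 := by
  have hxv : ∀ v, x v - t * ∑ w ∈ G.neighborFinset v, x w
      + t ^ 2 * (G.degree v * x v - x v) = 0 := fun v => by
    rw [← iharaMatrix_mulVec_apply, hx, Pi.zero_apply]
  have ht2 : 1 - t ^ 2 ≠ 0 := by nlinarith
  by_contra hx0
  -- If the lift vanishes on both orientations of an edge, then `(1 - t²) x = 0` at its ends; at an
  -- isolated vertex this is the kernel equation itself.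
  have hne : ∃ u v, G.Adj u v ∧ x u - t * x v ≠ 0 := by
    by_contra! hall
    refine hx0 (funext fun v => ?_)
    rw [Pi.zero_apply]
    by_cases hv : ∃ w, G.Adj v w
    · obtain ⟨w, hw⟩ := hv
      have h1 := hall v w hw
      have h2 := hall w v hw.symm
      have h3 : (1 - t ^ 2) * x v = 0 := by linear_combination h1 + t * h2
      exact (mul_eq_zero.1 h3).resolve_left ht2
    · have hN : G.neighborFinset v = ∅ := by
        ext w
        simpa using fun hw => hv ⟨w, hw⟩
      have hd : G.degree v = 0 := by rw [← card_neighborFinset_eq_degree, hN, Finset.card_empty]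
      have h := hxv v
      rw [hN, hd] at h
      simp only [Finset.sum_empty, Nat.cast_zero] at h
      have h3 : (1 - t ^ 2) * x v = 0 := by linear_combination h
      exact (mul_eq_zero.1 h3).resolve_left ht2
  obtain ⟨a, b, hab, hgab⟩ := hne
  have hpow := pow_le_card_of_nonbacktracking_eigenfunction hG (g := fun u v => x v - t * x u)
    (r := t⁻¹) (inv_nonneg.2 ht0.le) (fun u v huv => by
      have hu : u ∈ G.neighborFinset v := by simpa using huv.symm
      have hs := Finset.add_sum_erase _ (fun w => x w - t * x v) hu
      have hv := hxv v
      have hfull : ∑ w ∈ G.neighborFinset v, (x w - t * x v) =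
          ∑ w ∈ G.neighborFinset v, x w - G.degree v * (t * x v) := by
        simp [Finset.sum_sub_distrib]
      rw [hfull] at hs
      rw [inv_mul_eq_div, eq_div_iff ht0.ne']
      linear_combination t * hs - hv) ⟨b, a, hab.symm, hgab⟩
  rw [inv_pow] at hpow
  have htk0 : 0 < t ^ k := pow_pos ht0 k
  have := mul_le_mul_of_nonneg_left hpow htk0.le
  rw [mul_inv_cancel₀ htk0.ne'] at this
  linarith

end SimpleGraph

open Matrix in
/-- A continuous family of real symmetric matrices that starts positive definite and is
nonsingular on `[0, b)` is positive semidefinite at `b`. -/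
theorem Matrix.posSemidef_of_continuous_of_nonsingular {n : Type*} [Fintype n]
    {M : ℝ → Matrix n n ℝ} (hM : Continuous M) (hherm : ∀ t, (M t).IsHermitian) {b : ℝ}
    (hb : 0 ≤ b) (h0 : ∀ x : n → ℝ, x ≠ 0 → 0 < x ⬝ᵥ M 0 *ᵥ x)
    (hsing : ∀ t, 0 < t → t < b → ∀ x, M t *ᵥ x = 0 → x = 0) : (M b).PosSemidef := by
  have hq : Continuous fun p : ℝ × (n → ℝ) => p.2 ⬝ᵥ M p.1 *ᵥ p.2 := by fun_prop
  have hscale : ∀ (t c : ℝ) (x : n → ℝ),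
      (c • x) ⬝ᵥ M t *ᵥ (c • x) = c ^ 2 * (x ⬝ᵥ M t *ᵥ x) := by
    intro t c x
    simp only [mulVec_smul, smul_dotProduct, dotProduct_smul, smul_eq_mul]
    ring
  have hpsd : ∀ t, (∀ x, 0 ≤ x ⬝ᵥ M t *ᵥ x) → (M t).PosSemidef := fun t ht =>
    .of_dotProduct_mulVec_nonneg (hherm t) (by simpa using ht)
  by_contra hneg
  have hKc : IsCompact ((Set.Icc 0 b ×ˢ Metric.sphere (0 : n → ℝ) 1) ∩
      {p | p.2 ⬝ᵥ M p.1 *ᵥ p.2 ≤ 0}) :=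
    (isCompact_Icc.prod (isCompact_sphere _ _)).inter_right (isClosed_le hq continuous_const)
  set K := (Set.Icc 0 b ×ˢ Metric.sphere (0 : n → ℝ) 1) ∩ {p | p.2 ⬝ᵥ M p.1 *ᵥ p.2 ≤ 0} with hK
  have hmemK : ∀ t ∈ Set.Icc 0 b, ∀ x ≠ 0, x ⬝ᵥ M t *ᵥ x ≤ 0 → ∃ y, (t, y) ∈ K := by
    intro t ht x hx hxt
    have hx' : ‖x‖ ≠ 0 := norm_ne_zero_iff.2 hx
    refine ⟨‖x‖⁻¹ • x, ⟨ht, by simp [norm_smul, hx']⟩, ?_⟩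
    simp only [Set.mem_ofPred_eq, hscale]
    exact mul_nonpos_of_nonneg_of_nonpos (sq_nonneg _) hxt
  have hKne : K.Nonempty := by
    have : ¬ ∀ x, 0 ≤ x ⬝ᵥ M b *ᵥ x := fun h => hneg (hpsd b h)
    push Not at this
    obtain ⟨x, hx⟩ := this
    obtain ⟨y, hy⟩ := hmemK b ⟨hb, le_rfl⟩ x (by rintro rfl; simp at hx) hx.le
    exact ⟨_, hy⟩
  -- `s` is the first parameter at which the form fails to be positive definite.
  obtain ⟨⟨s, x⟩, ⟨⟨hs, hx⟩, hsx⟩, hmin⟩ := hKc.exists_isMinOn hKne continuous_fst.continuousOn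
  simp only [Set.mem_ofPred_eq] at hs hx hsx
  have hx0 : x ≠ 0 := by
    rintro rfl
    simp at hx
  have hs0 : 0 < s := by
    refine lt_of_le_of_ne hs.1 ?_
    rintro rfl
    exact absurd (h0 x hx0) hsx.not_gt
  have hlt : ∀ t ∈ Set.Ioo 0 s, ∀ y, 0 ≤ y ⬝ᵥ M t *ᵥ y := by
    intro t ht y
    by_contra! hy
    obtain ⟨z, hz⟩ := hmemK t ⟨ht.1.le, ht.2.le.trans hs.2⟩ y (by rintro rfl; simp at hy) hy.le
    exact absurd (hmin hz) (not_le.2 ht.2)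
  have hspsd : (M s).PosSemidef := by
    refine hpsd s fun y => ?_
    have hclosed : IsClosed {t | 0 ≤ y ⬝ᵥ M t *ᵥ y} :=
      isClosed_le continuous_const (hq.comp (by fun_prop : Continuous fun t : ℝ => (t, y)))
    have hsub : Set.Ioo 0 s ⊆ {t | 0 ≤ y ⬝ᵥ M t *ᵥ y} := fun t ht => hlt t ht y
    have hmem : s ∈ closure (Set.Ioo 0 s) := by
      rw [closure_Ioo hs0.ne]
      exact ⟨hs0.le, le_rfl⟩
    exact hclosed.closure_subset_iff.2 hsub hmem
  rcases hs.2.lt_or_eq with hsb | rfl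
  -- A null vector of a positive semidefinite form lies in the kernel.
  · refine hx0 (hsing s hs0 hsb x ((hspsd.dotProduct_mulVec_zero_iff x).1 ?_))
    refine le_antisymm (by simpa using hsx) ?_
    exact hspsd.dotProduct_mulVec_nonneg x
  · exact hneg hspsd

/-! ### The two Moore bounds -/

namespace SimpleGraph

open Matrix

variable {V : Type*} [Fintype V] [DecidableEq V] {G : SimpleGraph V} [DecidableRel G.Adj]

theorem posSemidef_iharaMatrix {k : ℕ} (hk : k ≠ 0) (hG : ¬ G.HasCycleOfLengthLE (2 * k)) {b : ℝ}
    (hb0 : 0 ≤ b) (hb1 : b ≤ 1) (hbk : b ^ k * Fintype.card V ≤ 1) :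
    (G.iharaMatrix b).PosSemidef := by
  refine posSemidef_of_continuous_of_nonsingular (M := G.iharaMatrix) ?_ isHermitian_iharaMatrix hb0
    (fun x hx => ?_) fun t ht0 htb x hx => ?_
  · unfold iharaMatrix
    fun_prop
  · simpa [iharaMatrix] using dotProduct_self_star_pos_iff.2 hx
  · rcases isEmpty_or_nonempty V with hV | hV
    · exact Subsingleton.elim _ _
    refine eq_zero_of_iharaMatrix_mulVec_eq_zero hG ht0 (htb.trans_le hb1) ?_ hx
    refine lt_of_lt_of_le ?_ hbk
    have hn : (0 : ℝ) < Fintype.card V := by exact_mod_cast Fintype.card_pos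
    gcongr

/-- The spectral Moore bound: `A ≼ n ^ (1 / k) I + n ^ (-1 / k) (D - I)` if there is no cycle of
length at most `2 * k`. -/
theorem posSemidef_of_not_hasCycleOfLengthLE {k : ℕ} (hk : k ≠ 0)
    (hG : ¬ G.HasCycleOfLengthLE (2 * k)) :
    (((Fintype.card V : ℝ) ^ (k⁻¹ : ℝ)) • (1 : Matrix V V ℝ)
      + ((Fintype.card V : ℝ) ^ (-(k⁻¹ : ℝ))) • (G.degMatrix ℝ - 1)
      - G.adjMatrix ℝ).PosSemidef := by
  rcases isEmpty_or_nonempty V with hV | hV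
  · convert Matrix.PosSemidef.zero
    exact Subsingleton.elim _ _
  have hn1 : (1 : ℝ) ≤ Fintype.card V := by exact_mod_cast Fintype.card_pos
  have hn : (0 : ℝ) < Fintype.card V := by linarith
  set c := (Fintype.card V : ℝ) ^ (k⁻¹ : ℝ) with hc
  have hc1 : 1 ≤ c := Real.one_le_rpow hn1 (by positivity)
  have hc0 : 0 < c := by linarith
  have hck : c ^ k = Fintype.card V := Real.rpow_inv_natCast_pow hn.le hk
  have hpsd := posSemidef_iharaMatrix (b := c⁻¹) hk hG (by positivity) (inv_le_one_of_one_le₀ hc1)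
    (by rw [inv_pow, hck, inv_mul_cancel₀ hn.ne'])
  have heq : c • (1 : Matrix V V ℝ) + ((Fintype.card V : ℝ) ^ (-(k⁻¹ : ℝ))) • (G.degMatrix ℝ - 1)
      - G.adjMatrix ℝ = c • G.iharaMatrix c⁻¹ := by
    have h2 : c * c⁻¹ ^ 2 = c⁻¹ := by field_simp
    rw [Real.rpow_neg hn.le, ← hc, iharaMatrix, smul_add, smul_sub c, smul_smul, smul_smul,
      mul_inv_cancel₀ hc0.ne', h2, one_smul]
    abel
  rw [heq]
  exact hpsd.smul hc0.le

/-- The Moore bound for irregular graphs, in the form `d - 1 ≤ n ^ (1 / k)`. -/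
theorem averageDegree_sub_one_pow_le {k : ℕ} (hk : k ≠ 0) (hG : ¬ G.HasCycleOfLengthLE (2 * k))
    (hd : 2 < G.averageDegree) : (G.averageDegree - 1) ^ k ≤ Fintype.card V := by
  -- `n > 1` makes `c > 1` strict, so that the factor `c - 1` below can be cancelled.
  have hcard : 1 < Fintype.card V := by
    by_contra! hle
    have : Subsingleton V := Fintype.card_le_one_iff_subsingleton.1 hle
    have hdeg : ∀ v, G.degree v = 0 := by
      intro v
      rw [← card_neighborFinset_eq_degree, Finset.card_eq_zero]
      ext w
      simp
    simp only [averageDegree, hdeg, Nat.cast_zero, Finset.sum_const_zero, zero_div] at hd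
    linarith
  have hn1 : (1 : ℝ) < Fintype.card V := by exact_mod_cast hcard
  have hn : (0 : ℝ) < Fintype.card V := by linarith
  have hsum : ∑ v, (G.degree v : ℝ) = G.averageDegree * Fintype.card V := by
    rw [averageDegree, div_mul_cancel₀ _ hn.ne']
  set c := (Fintype.card V : ℝ) ^ (k⁻¹ : ℝ) with hc
  have hc1 : 1 < c := Real.one_lt_rpow hn1 (by positivity)
  have hck : c ^ k = Fintype.card V := Real.rpow_inv_natCast_pow hn.le hk
  -- The quadratic form at the all-ones vector.
  have hquad : 0 ≤ Fintype.card V * c + c⁻¹ * (G.averageDegree * Fintype.card V - Fintype.card V)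
      - G.averageDegree * Fintype.card V := by
    have h := (posSemidef_of_not_hasCycleOfLengthLE hk hG).dotProduct_mulVec_nonneg (fun _ => 1)
    rw [← hc, Real.rpow_neg hn.le, ← hc] at h
    simpa [dotProduct, sub_mulVec, add_mulVec, smul_mulVec, degMatrix_mulVec_apply,
      adjMatrix_mulVec_apply, Finset.sum_add_distrib, Finset.sum_sub_distrib, ← Finset.mul_sum,
      hsum] using h
  have hfac : 0 ≤ (c - 1) * (c - (G.averageDegree - 1)) := by
    have h : Fintype.card V * c⁻¹ * ((c - 1) * (c - (G.averageDegree - 1))) =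
        Fintype.card V * c + c⁻¹ * (G.averageDegree * Fintype.card V - Fintype.card V)
          - G.averageDegree * Fintype.card V := by
      field_simp
      ring
    rw [← h] at hquad
    exact nonneg_of_mul_nonneg_right hquad (by positivity)
  have hle : G.averageDegree - 1 ≤ c := by
    have := nonneg_of_mul_nonneg_right hfac (by linarith)
    linarith
  calc (G.averageDegree - 1) ^ k ≤ c ^ k := pow_le_pow_left₀ (by linarith) hle k
    _ = Fintype.card V := hck

end SimpleGraph

theorem theoremA1 {V : Type*} [Fintype V] [DecidableEq V] (G : SimpleGraph V)
    [DecidableRel G.Adj] :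
    (2 < G.averageDegree →
      G.HasCycleOfLengthLE
        (2 * (⌊Real.logb (G.averageDegree - 1) (Fintype.card V : ℝ)⌋₊ + 1))) ∧
    (∀ ℓ : ℕ, 0 < ℓ → Even ℓ → ¬ G.HasCycleOfLengthLE ℓ →
      Matrix.PosSemidef
        (((Fintype.card V : ℝ) ^ ((2 : ℝ) / (ℓ : ℝ))) • (1 : Matrix V V ℝ)
          + ((Fintype.card V : ℝ) ^ (-((2 : ℝ) / (ℓ : ℝ)))) • (G.degMatrix ℝ - 1)
          - G.adjMatrix ℝ)) := by
  refine ⟨fun hd => ?_, fun ℓ hℓ heven hG => ?_⟩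
  · by_contra hG
    have hpow := SimpleGraph.averageDegree_sub_one_pow_le (Nat.succ_ne_zero _) hG hd
    -- The exponent `k = ⌊log⌋₊ + 1` exceeds the logarithm, so `(d - 1)^k > n`.
    have hlog := Nat.lt_floor_add_one (Real.logb (G.averageDegree - 1) (Fintype.card V : ℝ))
    have hn : (0 : ℝ) < Fintype.card V :=
      lt_of_lt_of_le (pow_pos (by linarith) _) hpow
    rw [Real.logb_lt_iff_lt_rpow (by linarith) hn] at hlog
    refine absurd hpow (not_le.2 ?_)
    rw [← Real.rpow_natCast]
    exact_mod_cast hlog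
  · obtain ⟨k, rfl⟩ := heven
    rw [← two_mul] at hG
    have hk : k ≠ 0 := by lia
    have hexp : (2 : ℝ) / ((k + k : ℕ) : ℝ) = (k : ℝ)⁻¹ := by
      push_cast
      field_simp
      norm_num
    rw [hexp]
    exact SimpleGraph.posSemidef_of_not_hasCycleOfLengthLE hk hG
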